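/- **Setting.** A *convex combination space* (CC space) is a metric space $(\mathfrak X,d)$ with an operation assigning to all $n\ge 1$, $\lambda_1,\dots,\lambda_n>0$ with $\sum_i\lambda_i=1$ and $u_1,\dots,u_n\in\mathfrak X$ a point $[\lambda_i,u_i]_{i=1}^n=[\lambda_1,u_1;\dots;\lambda_n,u_n]\in\mathfrak X$, such that $[1,u]=u$ and: (i) $[\lambda_i,u_i]_{i=1}^n=[\lambda_{\sigma(i)},u_{\sigma(i)}]_{i=1}^n$ for every permutation $\sigma$; (ii) $[\lambda_i,u_i]_{i=1}^{n+2}=\big[\lambda_1,u_1;\dots;\lambda_n,u_n;\lambda_{n+1}+\lambda_{n+2},\big[\tfrac{\lambda_{n+j}}{\lambda_{n+1}+\lambda_{n+2}},u_{n+j}\big]_{j=1}^2\big]$; (iii) if $\lambda^{(k)}\to\lambda$ with $\lambda^{(k)},\lambda\in(0,1)$, then $[\lambda^{(k)},u;1-\lambda^{(k)},v]\to[\lambda,u;1-\lambda,v]$; (iv) $d([\lambda,u_1;1-\lambda,u_2],[\lambda,v_1;1-\lambda,v_2])\le\lambda d(u_1,v_1)+(1-\lambda)d(u_2,v_2)$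 for $\lambda\in(0,1)$; (v) for each $u\in\mathfrak X$ the limit $Ku:=\lim_{n\to\infty}[\tfrac1n,u]_{i=1}^n$ exists. $\mathfrak X$ is *convexifiable* if $K(\mathfrak X)=\mathfrak X$. A map $\varphi:\mathfrak X\to\mathbb R$ is *convex* if $\varphi([\lambda_i,x_i]_{i=1}^n)\le\sum_i\lambda_i\varphi(x_i)$ for all $x_i\in\mathfrak X$ and $\lambda_i\in(0,1)$ with $\sum_i\lambda_i=1$, and *affine* if $\varphi$ and $-\varphi$ are convex. Let $\mathfrak X'$ be the set of continuous affine maps $\mathfrak X\to\mathbb R$. Let $(\Omega,\mathcal F,P)$ be a probability space. A Borel measurable $X:\Omega\to\mathfrak X$ is an *integrable random element* if $E\,d(a,X)<\infty$ for some $a\in\mathfrak X$. If a random element $Y$ takes finitely many values, its expectation is $EY=[P(Y=x),Kx]_x$, where $x$ runs over the values with $P(Y=x)>0$. If $\mathfrak X$ is separable and complete, fix $u_0\in K(\mathfrak X)$ and a sequence $(u_j)_{j\ge1}$ dense in $\mathfrak X$, let $\psi_n(x)$ be the point among $u_0,\dots,u_n$ that is nearest to $x$ (of least index in case of ties), and for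 an integrable random element $X$ let $EX=\lim_{n\to\infty}E\psi_n(X)$. **Theorem 4.4.** Let $\mathfrak X$ be a separable, complete, convexifiable CC space, and let $X$ be an integrable $\mathfrak X$-valued random element. Then, for every choice of $(u_j)_{j\ge 0}$ as above: 1. $f(X)$ is integrable for every $f\in\mathfrak X'$. 2. The limit $EX$ exists, and for every $m\in\mathfrak X$ we have $m=EX$ if and only if $f(m)=E f(X)$ for all $f\in\mathfrak X'$. -/

import Mathlib

open MeasureTheory Filter Topology

/-- A convex combination space on the metric space `𝔛`. The element `comb w u` is
`[w₁, u₁; …; wₙ, uₙ]`; it is meaningful for positive weights `w` of sum one, and the axioms speak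
about such weights only (on all other weights `comb` is an unspecified value that is never
used). -/
class CCSpace (𝔛 : Type*) [MetricSpace 𝔛] where
  /-- The convex combination operation. -/
  comb : ∀ {n : ℕ}, (Fin n → ℝ) → (Fin n → 𝔛) → 𝔛
  /-- `[1, u] = u`. -/
  comb_one : ∀ u : 𝔛, comb (fun _ : Fin 1 => (1 : ℝ)) (fun _ => u) = u
  /-- Commutativity. -/
  comb_perm : ∀ {n : ℕ} (w : Fin n → ℝ) (u : Fin n → 𝔛) (σ : Equiv.Perm (Fin n)),
    (∀ i, 0 < w i) → ∑ i, w i = 1 →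
      comb w u = comb (fun i => w (σ i)) (fun i => u (σ i))
  /-- Associativity: the last two entries may be combined first. -/
  comb_assoc : ∀ {n : ℕ} (w : Fin n → ℝ) (u : Fin n → 𝔛) (a b : ℝ) (x y : 𝔛),
    (∀ i, 0 < w i) → 0 < a → 0 < b → ∑ i, w i + a + b = 1 →
      comb (Fin.snoc (α := fun _ => ℝ) (Fin.snoc (α := fun _ => ℝ) w a) b)
          (Fin.snoc (α := fun _ => 𝔛) (Fin.snoc (α := fun _ => 𝔛) u x) y) =
        comb (Fin.snoc (α := fun _ => ℝ) w (a + b))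
          (Fin.snoc (α := fun _ => 𝔛) u (comb ![a / (a + b), b / (a + b)] ![x, y]))
  /-- Continuity in the weights of binary combinations. -/
  comb_continuous : ∀ (x y : 𝔛) (t : ℕ → ℝ) (s : ℝ),
    (∀ k, t k ∈ Set.Ioo (0 : ℝ) 1) → s ∈ Set.Ioo (0 : ℝ) 1 → Tendsto t atTop (𝓝 s) →
      Tendsto (fun k => comb ![t k, 1 - t k] ![x, y]) atTop (𝓝 (comb ![s, 1 - s] ![x, y]))
  /-- Negative curvature. -/
  dist_comb_le : ∀ (x₁ x₂ y₁ y₂ : 𝔛) (s : ℝ), s ∈ Set.Ioo (0 : ℝ) 1 →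
    dist (comb ![s, 1 - s] ![x₁, x₂]) (comb ![s, 1 - s] ![y₁, y₂]) ≤
      s * dist x₁ y₁ + (1 - s) * dist x₂ y₂
  /-- Convexification: `[1/n, x; …; 1/n, x]` converges as `n → ∞`. -/
  exists_tendsto : ∀ x : 𝔛, ∃ l : 𝔛,
    Tendsto (fun n : ℕ => comb (fun _ : Fin n => (n : ℝ)⁻¹) (fun _ => x)) atTop (𝓝 l)

namespace CCSpace

section Basic

variable {𝔛 : Type*} [MetricSpace 𝔛] [CCSpace 𝔛]

/-- The convexification operator `K`: the limit of `[1/n, x; …; 1/n, x]` as `n → ∞`. -/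
noncomputable def convexify (x : 𝔛) : 𝔛 := (exists_tendsto x).choose

variable (𝔛) in
/-- The convexifiable domain `K(𝔛)`. -/
def convexifiableDomain : Set 𝔛 := Set.range (convexify : 𝔛 → 𝔛)

variable (𝔛) in
/-- The space is convexifiable if `K(𝔛) = 𝔛`. -/
def IsConvexifiable : Prop := convexifiableDomain 𝔛 = Set.univ

/-- Convex real functions on a convex combination space. -/
def IsConvex (φ : 𝔛 → ℝ) : Prop :=
  ∀ (n : ℕ) (w : Fin n → ℝ) (x : Fin n → 𝔛), (∀ i, w i ∈ Set.Ioo (0 : ℝ) 1) → ∑ i, w i = 1 →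
    φ (comb w x) ≤ ∑ i, w i * φ (x i)

/-- Affine real functions: both `φ` and `-φ` are convex. -/
def IsAffine (φ : 𝔛 → ℝ) : Prop := IsConvex φ ∧ IsConvex (fun x => -φ x)

variable (𝔛) in
/-- The set `𝔛'` of all continuous affine functions `𝔛 → ℝ`. -/
def affineDual : Set (𝔛 → ℝ) := {f | Continuous f ∧ IsAffine f}

/-- The combination `[w x, v x]` over the elements `x` of a finite set, listed in some order (by
commutativity the order does not matter). -/
noncomputable def finsetComb {ι : Type*} (s : Finset ι) (w : ι → ℝ) (v : ι → 𝔛) : 𝔛 :=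
  comb (fun i : Fin s.card => w (s.equivFin.symm i)) (fun i => v (s.equivFin.symm i))

end Basic

section Expectation

variable {Ω 𝔛 : Type*} [MeasurableSpace Ω] [MetricSpace 𝔛] [CCSpace 𝔛]

open Classical in
/-- The expectation `[P(Y = x), K x]` of a simple random element `Y`, the combination being taken
over the values `x` that `Y` attains with positive probability (zero weights are dropped). -/
noncomputable def simpleExpectation (P : Measure Ω) (Y : SimpleFunc Ω 𝔛) : 𝔛 :=
  finsetComb (Y.range.filter fun x => 0 < P.real (Y ⁻¹' {x}))
    (fun x => P.real (Y ⁻¹' {x})) convexify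

/-- `m` is the expectation of the random element `X`, that is, the limit of the expectations of the
simple random elements `ψₙ(X)`. Here `ψₙ(x)` is the point nearest to `x` among `u 0, …, u n`
(the one of least index, if there are several). -/
def IsExpectation [MeasurableSpace 𝔛] [OpensMeasurableSpace 𝔛] (P : Measure Ω) (u : ℕ → 𝔛)
    (X : Ω → 𝔛) (hX : Measurable X) (m : 𝔛) : Prop :=
  Tendsto (fun n : ℕ => simpleExpectation P ((SimpleFunc.nearestPt u n).comp X hX)) atTop (𝓝 m)

/-- Integrability of a random element: `d(a, X)` is integrable for some point `a`. -/
def IsIntegrable (P : Measure Ω) (X : Ω → 𝔛) : Prop :=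
  ∃ a : 𝔛, Integrable (fun ω => dist a (X ω)) P

end Expectation

end CCSpace

/-! The core is a separation result (`IsConvexifiable.exists_isAffine_sub_eq_dist`): any two points
of a convexifiable space are told apart, at their exact distance, by a 1-Lipschitz affine function.
Given this, the expectation is a statement about real integrals. On simple elements affine functions
commute with the expectation, so a separating function shows that it is nonexpansive for the L¹
distance; hence the expectations of ψₙ(X) form a Cauchy sequence. Dominated convergence carries
f(EX) = E f(X) to the limit, and separation makes EX the only point with this property.

For the separation, points with positive masses form a commutative semigroup in which a convex
combination is a sum. Convexifiability makes masses at the same point add up. The distance weighted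
by mass then satisfies a cancellation law, as in Rådström's embedding
(`IsConvexifiable.gap_add_right`). So comparing the barycenters of the positive and negative parts
gives a seminorm on signed measures of total mass zero, and Hahn–Banach supplies a functional whose
values on point masses are the required function. -/

namespace CCSpace

/-! ### Convex combinations as sums of weighted points. -/

section Atom

variable {𝔛 : Type*}

variable (𝔛) in
/-- Points of `𝔛` carrying a positive mass. -/
@[ext]
structure Cone where
  /-- The mass. -/
  mass : ℝ
  /-- The mass is positive. -/
  mass_pos : 0 < mass
  /-- The point. -/
  point : 𝔛

/-- The point `x` with mass `a`, zero if `a` is not positive. -/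
noncomputable def atom (a : ℝ) (x : 𝔛) : WithZero (Cone 𝔛) :=
  if h : 0 < a then ((⟨a, h, x⟩ : Cone 𝔛) : WithZero (Cone 𝔛)) else 0

theorem atom_of_pos {a : ℝ} (h : 0 < a) (x : 𝔛) :
    atom a x = ((⟨a, h, x⟩ : Cone 𝔛) : WithZero (Cone 𝔛)) := dif_pos h

theorem atom_zero (x : 𝔛) : atom 0 x = 0 := dif_neg (lt_irrefl _)

theorem atom_injective {a : ℝ} (h : 0 < a) {x y : 𝔛} (hxy : atom a x = atom a y) : x = y := by
  rw [atom_of_pos h, atom_of_pos h, WithZero.coe_inj] at hxy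
  exact congrArg Cone.point hxy

end Atom

section Cone

variable {𝔛 : Type*} [MetricSpace 𝔛] [CCSpace 𝔛]

/-- The binary combination of `x` and `y` with weights proportional to `a` and `b`. -/
noncomputable def mix (a b : ℝ) (x y : 𝔛) : 𝔛 := comb ![a / (a + b), b / (a + b)] ![x, y]

theorem mix_self_one_sub (s : ℝ) (x y : 𝔛) : mix s (1 - s) x y = comb ![s, 1 - s] ![x, y] := by
  simp [mix]

theorem mix_eq_mix_div {a b : ℝ} (ha : 0 < a) (hb : 0 < b) (x y : 𝔛) :
    mix a b x y = comb ![a / (a + b), 1 - a / (a + b)] ![x, y] := by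
  have : 1 - a / (a + b) = b / (a + b) := by field_simp; ring
  rw [this, mix]

theorem mix_mul_mul {t : ℝ} (ht : 0 < t) (a b : ℝ) (x y : 𝔛) :
    mix (t * a) (t * b) x y = mix a b x y := by
  simp only [mix, ← mul_add, mul_div_mul_left _ _ ht.ne']

theorem mix_comm {a b : ℝ} (ha : 0 < a) (hb : 0 < b) (x y : 𝔛) : mix a b x y = mix b a y x := by
  rw [mix, comb_perm _ _ (Equiv.swap 0 1), mix]
  · congr 1 <;> funext i <;> fin_cases i <;> simp [add_comm]
  · intro i
    fin_cases i <;> simp <;> positivity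
  · simp [← add_div, (add_pos ha hb).ne']

theorem comb_three {a b c : ℝ} (ha : 0 < a) (hb : 0 < b) (hc : 0 < c) (h : a + b + c = 1)
    (x y z : 𝔛) : comb ![a, b, c] ![x, y, z] = mix a (b + c) x (mix b c y z) := by
  have key := comb_assoc (n := 1) ![a] ![x] b c y z (by simpa using ha) hb hc (by simpa using h)
  have e1 : Fin.snoc (α := fun _ => ℝ) (Fin.snoc (α := fun _ => ℝ) ![a] b) c = ![a, b, c] := by
    funext i; fin_cases i <;> rfl
  have e2 : Fin.snoc (α := fun _ => 𝔛) (Fin.snoc (α := fun _ => 𝔛) ![x] y) z = ![x, y, z] := by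
    funext i; fin_cases i <;> rfl
  have e3 : Fin.snoc (α := fun _ => ℝ) ![a] (b + c) = ![a, b + c] := by
    funext i; fin_cases i <;> rfl
  have e4 (w : 𝔛) : Fin.snoc (α := fun _ => 𝔛) ![x] w = ![x, w] := by
    funext i; fin_cases i <;> rfl
  rw [e1, e2, e3, e4] at key
  rw [key, mix, mix]
  simp [← add_assoc, h]

theorem mix_assoc_of_sum_eq_one {a b c : ℝ} (ha : 0 < a) (hb : 0 < b) (hc : 0 < c)
    (h : a + b + c = 1) (x y z : 𝔛) :
    mix (a + b) c (mix a b x y) z = mix a (b + c) x (mix b c y z) := by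
  rw [← comb_three ha hb hc h, mix_comm (add_pos ha hb) hc,
    ← comb_three hc ha hb (by linarith),
    comb_perm _ _ (finRotate 3)]
  · congr 1 <;> funext i <;> fin_cases i <;> rfl
  · intro i
    fin_cases i <;> assumption
  · simpa [Fin.sum_univ_three] using by linarith

theorem mix_assoc {a b c : ℝ} (ha : 0 < a) (hb : 0 < b) (hc : 0 < c) (x y z : 𝔛) :
    mix (a + b) c (mix a b x y) z = mix a (b + c) x (mix b c y z) := by
  have hs : 0 < (a + b + c)⁻¹ := by positivity
  rw [← mix_mul_mul hs (a + b) c, ← mix_mul_mul hs a b, ← mix_mul_mul hs a (b + c),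
    ← mix_mul_mul hs b c, mul_add, mul_add]
  refine mix_assoc_of_sum_eq_one (by positivity) (by positivity) (by positivity) ?_ x y z
  rw [← mul_add, ← mul_add]
  exact inv_mul_cancel₀ (by positivity)

/-- Axioms (i) and (ii) for three entries, freed from the normalization of the weights by
homogeneity of `mix`, are exactly commutativity and associativity here. -/
noncomputable instance : AddCommSemigroup (Cone 𝔛) where
  add p q := ⟨p.mass + q.mass, add_pos p.mass_pos q.mass_pos, mix p.mass q.mass p.point q.point⟩
  add_assoc p q r := Cone.ext (add_assoc _ _ _) (mix_assoc p.mass_pos q.mass_pos r.mass_pos _ _ _)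
  add_comm p q := Cone.ext (add_comm _ _) (mix_comm p.mass_pos q.mass_pos _ _)

theorem atom_add_atom {a b : ℝ} (ha : 0 < a) (hb : 0 < b) (x y : 𝔛) :
    atom a x + atom b y = atom (a + b) (mix a b x y) := by
  rw [atom_of_pos ha, atom_of_pos hb, atom_of_pos (add_pos ha hb), ← WithZero.coe_add]
  rfl

/-- Axiom (ii) merges the last two atoms into one, which is the induction step. From here on
regrouping a combination is algebra in a commutative monoid. -/
theorem sum_atom_eq_atom_comb {n : ℕ} (w : Fin n → ℝ) (u : Fin n → 𝔛) (hw : ∀ i, 0 < w i)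
    (h : ∑ i, w i = 1) : ∑ i, atom (w i) (u i) = atom 1 (comb w u) := by
  induction n with
  | zero => simp at h
  | succ n ih =>
    match n with
    | 0 =>
      have hw1 : w = fun _ => 1 := by funext i; fin_cases i; simpa using h
      have hu : u = fun _ => u 0 := by funext i; fin_cases i; rfl
      rw [hw1, hu, comb_one]
      simp
    | 1 =>
      rw [Fin.sum_univ_two] at h ⊢
      rw [atom_add_atom (hw 0) (hw 1), mix, h, div_one, div_one]
      congr 2 <;> funext i <;> fin_cases i <;> rfl
    | n + 2 =>
      set w' : Fin (n + 1) → ℝ := fun i => w i.castSucc.castSucc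
      set u' : Fin (n + 1) → 𝔛 := fun i => u i.castSucc.castSucc
      set a := w (Fin.last _).castSucc
      set b := w (Fin.last _)
      set x := u (Fin.last _).castSucc
      set y := u (Fin.last _)
      have hws : w = Fin.snoc (α := fun _ => ℝ) (Fin.snoc (α := fun _ => ℝ) w' a) b := by
        funext i
        refine Fin.lastCases (by simp [b]) (fun j => ?_) i
        refine Fin.lastCases (by simp [a]) (fun k => by simp [w']) j
      have hus : u = Fin.snoc (α := fun _ => 𝔛) (Fin.snoc (α := fun _ => 𝔛) u' x) y := by
        funext i
        refine Fin.lastCases (by simp [y]) (fun j => ?_) i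
        refine Fin.lastCases (by simp [x]) (fun k => by simp [u']) j
      have hsum : ∑ i, w' i + a + b = 1 := by
        rw [← h, Fin.sum_univ_castSucc (n := n + 2), Fin.sum_univ_castSucc (n := n + 1)]
      have hw' : ∀ i, 0 < w' i := fun i => hw _
      have ha : 0 < a := hw _
      have hb : 0 < b := hw _
      rw [hws, hus, comb_assoc w' u' a b x y hw' ha hb hsum, ← ih]
      · rw [Fin.sum_univ_castSucc (n := n + 2), Fin.sum_univ_castSucc (n := n + 1),
          Fin.sum_univ_castSucc (n := n + 1)]
        simp only [Fin.snoc_castSucc, Fin.snoc_last]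
        rw [add_assoc, atom_add_atom ha hb, mix]
      · intro i
        refine Fin.lastCases ?_ (fun j => ?_) i
        · simpa using add_pos ha hb
        · simpa using hw' j
      · rw [Fin.sum_univ_castSucc]
        simpa [add_assoc] using hsum

/-- Multiplication of all masses by a positive number. -/
noncomputable def scale {t : ℝ} (ht : 0 < t) : WithZero (Cone 𝔛) →+ WithZero (Cone 𝔛) :=
  WithZero.mapAddHom
    { toFun := fun p => ⟨t * p.mass, mul_pos ht p.mass_pos, p.point⟩
      map_add' := fun _ _ => Cone.ext (mul_add _ _ _) (mix_mul_mul ht _ _ _ _).symm }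

theorem scale_atom {t : ℝ} (ht : 0 < t) (a : ℝ) (x : 𝔛) : scale ht (atom a x) = atom (t * a) x := by
  by_cases ha : 0 < a
  · rw [atom_of_pos ha, atom_of_pos (mul_pos ht ha)]
    rfl
  · have hta : ¬ 0 < t * a := fun h => ha (pos_of_mul_pos_right h ht.le)
    rw [atom, atom, dif_neg ha, dif_neg hta, map_zero]

end Cone

/-! ### Points in the image of K are idempotent. -/

section Idempotent

variable {𝔛 : Type*} [MetricSpace 𝔛] [CCSpace 𝔛]

theorem dist_mix_le {a b : ℝ} (ha : 0 < a) (hb : 0 < b) (x₁ x₂ y₁ y₂ : 𝔛) :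
    (a + b) * dist (mix a b x₁ x₂) (mix a b y₁ y₂) ≤ a * dist x₁ y₁ + b * dist x₂ y₂ := by
  have hab := add_pos ha hb
  have h := dist_comb_le x₁ x₂ y₁ y₂ (a / (a + b))
    ⟨by positivity, by rw [div_lt_one hab]; linarith⟩
  rw [← mix_eq_mix_div ha hb, ← mix_eq_mix_div ha hb] at h
  calc _ ≤ (a + b) * (a / (a + b) * dist x₁ y₁ + (1 - a / (a + b)) * dist x₂ y₂) := by gcongr
    _ = _ := by field_simp; ring

theorem tendsto_convexify (x : 𝔛) :
    Tendsto (fun n : ℕ => comb (fun _ : Fin n => (n : ℝ)⁻¹) (fun _ => x)) atTop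
      (𝓝 (convexify x)) :=
  (exists_tendsto x).choose_spec

/-- The averages that define K are the multiples of one unit atom, so relations between averages of
different lengths reduce to `add_nsmul`. -/
theorem nsmul_atom_one {n : ℕ} (hn : 0 < n) (x : 𝔛) :
    n • atom 1 x = atom n (comb (fun _ : Fin n => (n : ℝ)⁻¹) (fun _ => x)) := by
  have hn' : (0 : ℝ) < n := by exact_mod_cast hn
  have h := sum_atom_eq_atom_comb (fun _ : Fin n => (n : ℝ)⁻¹) (fun _ => x)
    (fun _ => inv_pos.2 hn') (by simp [hn'.ne'])
  have := congrArg (scale hn') h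
  simpa [scale_atom, hn'.ne'] using this

theorem mix_comb_const {k l : ℕ} (hk : 0 < k) (hl : 0 < l) (x : 𝔛) :
    mix k l (comb (fun _ : Fin k => (k : ℝ)⁻¹) (fun _ => x))
      (comb (fun _ : Fin l => (l : ℝ)⁻¹) (fun _ => x)) =
    comb (fun _ : Fin (k + l) => ((k + l : ℕ) : ℝ)⁻¹) (fun _ => x) := by
  have hk' : (0 : ℝ) < k := by exact_mod_cast hk
  have hl' : (0 : ℝ) < l := by exact_mod_cast hl
  apply atom_injective (add_pos hk' hl')
  rw [← atom_add_atom hk' hl', ← nsmul_atom_one hk, ← nsmul_atom_one hl, ← add_nsmul,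
    nsmul_atom_one (by omega)]
  push_cast
  rfl

/-- The average of (k + l)n copies is the k : l mixture of the averages of kn and of ln copies. All
three tend to Kx, and mixing is continuous by axiom (iv). -/
theorem mix_natCast_convexify {k l : ℕ} (hk : 0 < k) (hl : 0 < l) (x : 𝔛) :
    mix k l (convexify x) (convexify x) = convexify x := by
  have hk' : (0 : ℝ) < k := by exact_mod_cast hk
  have hl' : (0 : ℝ) < l := by exact_mod_cast hl
  set z : ℕ → 𝔛 := fun n => comb (fun _ : Fin n => (n : ℝ)⁻¹) (fun _ => x)
  have hz : Tendsto z atTop (𝓝 (convexify x)) := tendsto_convexify x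
  -- The factor n + 1 is never zero, so it can be cancelled from the weights below.
  have hsub {m : ℕ} (hm : 0 < m) : Tendsto (fun n => m * (n + 1)) atTop atTop :=
    tendsto_atTop_mono (fun n => (Nat.le_succ n).trans (Nat.le_mul_of_pos_left _ hm)) tendsto_id
  have h1 := hz.comp (hsub (Nat.add_pos_left hk l))
  have h2 := hz.comp (hsub hk)
  have h3 := hz.comp (hsub hl)
  refine tendsto_nhds_unique ?_ h1
  have hb : Tendsto (fun n => (k * dist (z (k * (n + 1))) (convexify x) +
      l * dist (z (l * (n + 1))) (convexify x)) / (k + l : ℝ)) atTop (𝓝 0) := by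
    have := (((tendsto_iff_dist_tendsto_zero.1 h2).const_mul (k : ℝ)).add
      ((tendsto_iff_dist_tendsto_zero.1 h3).const_mul (l : ℝ))).div_const (k + l : ℝ)
    simpa using this
  refine (tendsto_iff_of_dist (squeeze_zero (fun _ => dist_nonneg) (fun n => ?_) hb)).1
    tendsto_const_nhds
  rw [dist_comm, le_div_iff₀ (add_pos hk' hl'), mul_comm]
  have e : z ((k + l) * (n + 1)) = mix k l (z (k * (n + 1))) (z (l * (n + 1))) := by
    have hn : (0 : ℝ) < n + 1 := by positivity
    have := mix_comb_const (k := k * (n + 1)) (l := l * (n + 1)) (by positivity) (by positivity) x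
    rw [← add_mul] at this
    simp only [z]
    rw [← this]
    push_cast
    rw [mul_comm (k : ℝ), mul_comm (l : ℝ), mix_mul_mul hn]
  simp only [Function.comp_apply]
  rw [e]
  exact dist_mix_le hk' hl' _ _ _ _

/-- Rational weights are ratios k : l of positive integers; axiom (iii) extends the identity to real
weights by density. -/
theorem mix_convexify {a b : ℝ} (ha : 0 < a) (hb : 0 < b) (x : 𝔛) :
    mix a b (convexify x) (convexify x) = convexify x := by
  have hab := add_pos ha hb
  rw [mix_eq_mix_div ha hb]
  set s := a / (a + b)
  have hs : s ∈ Set.Ioo (0 : ℝ) 1 := ⟨by positivity, by rw [div_lt_one hab]; linarith⟩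
  have hrat : ∀ q : ℚ, (q : ℝ) ∈ Set.Ioo (0 : ℝ) 1 →
      comb ![(q : ℝ), 1 - q] ![convexify x, convexify x] = convexify x := by
    intro q hq
    have h0 : 0 < q := by exact_mod_cast hq.1
    have h1 : q < 1 := by exact_mod_cast hq.2
    have hnum : 0 < q.num := Rat.num_pos.2 h0
    have hlt : q.num < q.den := Rat.num_lt_denom_iff.2 h1
    obtain ⟨k, hk⟩ : ∃ k : ℕ, q.num = k := ⟨q.num.toNat, by omega⟩
    obtain ⟨l, hl⟩ : ∃ l : ℕ, q.den = k + l := ⟨q.den - k, by omega⟩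
    have hk0 : 0 < k := by omega
    have hl0 : 0 < l := by omega
    have hqk : (q : ℝ) = (k : ℝ) / (k + l) := by
      rw [Rat.cast_def, hk, hl]
      push_cast
      rfl
    rw [hqk, ← mix_eq_mix_div (by exact_mod_cast hk0) (by exact_mod_cast hl0),
      mix_natCast_convexify hk0 hl0]
  have hmem : s ∈ closure (Set.Ioo (0 : ℝ) 1 ∩ Set.range ((↑) : ℚ → ℝ)) :=
    Rat.denseRange_cast.open_subset_closure_inter isOpen_Ioo hs
  obtain ⟨t, ht, hts⟩ := mem_closure_iff_seq_limit.1 hmem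
  refine tendsto_nhds_unique
    (comb_continuous (convexify x) (convexify x) t s (fun k => (ht k).1) hs hts) ?_
  refine tendsto_const_nhds.congr fun k => ?_
  obtain ⟨q, hq⟩ := (ht k).2
  rw [← hq, hrat q (hq ▸ (ht k).1)]

theorem IsConvexifiable.mix_self (hconv : IsConvexifiable 𝔛) {a b : ℝ} (ha : 0 < a) (hb : 0 < b)
    (x : 𝔛) : mix a b x x = x := by
  obtain ⟨y, rfl⟩ : x ∈ convexifiableDomain 𝔛 := by rw [hconv]; trivial
  exact mix_convexify ha hb y

theorem IsConvexifiable.atom_add (hconv : IsConvexifiable 𝔛) {a b : ℝ} (ha : 0 ≤ a) (hb : 0 ≤ b)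
    (x : 𝔛) : atom (a + b) x = atom a x + atom b x := by
  rcases ha.eq_or_lt with rfl | ha
  · simp [atom_zero]
  rcases hb.eq_or_lt with rfl | hb
  · simp [atom_zero]
  rw [atom_add_atom ha hb, hconv.mix_self ha hb]

end Idempotent

/-! ### The distance weighted by mass, and its cancellation law. -/

section Gap

variable {𝔛 : Type*}

theorem eq_zero_or_eq_atom (a : WithZero (Cone 𝔛)) : a = 0 ∨ ∃ r x, 0 < r ∧ a = atom r x := by
  induction a using WithZero.recZeroCoe with
  | zero => exact Or.inl rfl
  | coe p => exact Or.inr ⟨p.mass, p.point, p.mass_pos, (atom_of_pos p.mass_pos p.point).symm⟩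

/-- The total mass. -/
noncomputable def mass : WithZero (Cone 𝔛) → ℝ
  | none => 0
  | some p => p.mass

theorem mass_zero : mass (0 : WithZero (Cone 𝔛)) = 0 := rfl

theorem mass_atom (a : ℝ) (x : 𝔛) : mass (atom a x) = max a 0 := by
  by_cases ha : 0 < a
  · rw [atom_of_pos ha, max_eq_left ha.le]
    rfl
  · rw [atom, dif_neg ha, mass_zero, max_eq_right (not_lt.1 ha)]

theorem mass_atom_of_pos {a : ℝ} (ha : 0 < a) (x : 𝔛) : mass (atom a x) = a := by
  rw [mass_atom, max_eq_left ha.le]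

theorem eq_zero_of_mass_eq_zero {a : WithZero (Cone 𝔛)} (h : mass a = 0) : a = 0 := by
  rcases eq_zero_or_eq_atom a with rfl | ⟨r, x, hr, rfl⟩
  · rfl
  · rw [mass_atom_of_pos hr] at h
    exact absurd h hr.ne'

theorem atom_max_zero (a : ℝ) (x : 𝔛) : atom (max a 0) x = atom a x := by
  rcases le_total a 0 with h | h
  · rw [max_eq_right h, atom_zero, atom, dif_neg (not_lt.2 h)]
  · rw [max_eq_left h]

variable (𝔛) in
/-- The total mass of a finitely supported signed measure. -/
noncomputable def total : (𝔛 →₀ ℝ) →ₗ[ℝ] ℝ := Finsupp.linearCombination ℝ fun _ => (1 : ℝ)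

theorem total_single (x : 𝔛) (a : ℝ) : total 𝔛 (Finsupp.single x a) = a := by
  simp [total]

variable [MetricSpace 𝔛]

/-- The distance of the locations of two elements of equal mass, multiplied by the mass. -/
noncomputable def gap : WithZero (Cone 𝔛) → WithZero (Cone 𝔛) → ℝ
  | some p, some q => p.mass * dist p.point q.point
  | _, _ => 0

theorem gap_zero_left (a : WithZero (Cone 𝔛)) : gap 0 a = 0 := rfl

theorem gap_zero_right (a : WithZero (Cone 𝔛)) : gap a 0 = 0 := by
  cases a <;> rfl

theorem gap_atom {a b : ℝ} (ha : 0 < a) (hb : 0 < b) (x y : 𝔛) :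
    gap (atom a x) (atom b y) = a * dist x y := by
  rw [atom_of_pos ha, atom_of_pos hb]
  rfl

theorem gap_nonneg (a b : WithZero (Cone 𝔛)) : 0 ≤ gap a b := by
  rcases eq_zero_or_eq_atom a with rfl | ⟨r, x, hr, rfl⟩
  · exact le_rfl
  rcases eq_zero_or_eq_atom b with rfl | ⟨s, y, hs, rfl⟩
  · rw [gap_zero_right]
  rw [gap_atom hr hs]
  positivity

theorem gap_self (a : WithZero (Cone 𝔛)) : gap a a = 0 := by
  rcases eq_zero_or_eq_atom a with rfl | ⟨r, x, hr, rfl⟩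
  · rfl
  · rw [gap_atom hr hr, dist_self, mul_zero]

/-- Equal masses matter: with b = 0 the right side would vanish. -/
theorem gap_triangle {a b c : WithZero (Cone 𝔛)} (hab : mass a = mass b) (hbc : mass b = mass c) :
    gap a c ≤ gap a b + gap b c := by
  rcases eq_zero_or_eq_atom a with rfl | ⟨r, x, hr, rfl⟩
  · rw [gap_zero_left]
    exact add_nonneg (gap_nonneg _ _) (gap_nonneg _ _)
  rcases eq_zero_or_eq_atom b with rfl | ⟨s, y, hs, rfl⟩
  · rw [mass_atom_of_pos hr, mass_zero] at hab
    exact absurd hab hr.ne'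
  rcases eq_zero_or_eq_atom c with rfl | ⟨t, z, ht, rfl⟩
  · rw [mass_atom_of_pos hs, mass_zero] at hbc
    exact absurd hbc hs.ne'
  rw [mass_atom_of_pos hr, mass_atom_of_pos hs] at hab
  subst hab
  rw [gap_atom hr hr, gap_atom hr ht, gap_atom hr ht, ← mul_add]
  gcongr
  exact dist_triangle _ _ _

variable [CCSpace 𝔛]

theorem mass_add (a b : WithZero (Cone 𝔛)) : mass (a + b) = mass a + mass b := by
  induction a using WithZero.recZeroCoe with
  | zero => simp [mass_zero]
  | coe p =>
    induction b using WithZero.recZeroCoe with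
    | zero => simp [mass_zero]
    | coe q => rfl

theorem mass_nsmul (n : ℕ) (a : WithZero (Cone 𝔛)) : mass (n • a) = n * mass a := by
  induction n with
  | zero => simp [mass_zero]
  | succ n ih => rw [succ_nsmul, mass_add, ih]; push_cast; ring

theorem mass_sum {ι : Type*} (s : Finset ι) (g : ι → WithZero (Cone 𝔛)) :
    mass (∑ i ∈ s, g i) = ∑ i ∈ s, mass (g i) :=
  map_sum (⟨⟨mass, mass_zero⟩, mass_add⟩ : WithZero (Cone 𝔛) →+ ℝ) g s

theorem gap_scale {t : ℝ} (ht : 0 < t) (a b : WithZero (Cone 𝔛)) :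
    gap (scale ht a) (scale ht b) = t * gap a b := by
  rcases eq_zero_or_eq_atom a with rfl | ⟨r, x, hr, rfl⟩
  · simp [gap_zero_left]
  rcases eq_zero_or_eq_atom b with rfl | ⟨s, y, hs, rfl⟩
  · simp [gap_zero_right]
  rw [scale_atom, scale_atom, gap_atom hr hs, gap_atom (mul_pos ht hr) (mul_pos ht hs), mul_assoc]

theorem gap_add_le {a b c : WithZero (Cone 𝔛)} (hab : mass a = mass b) :
    gap (a + c) (b + c) ≤ gap a b := by
  rcases eq_zero_or_eq_atom a with rfl | ⟨r, x, hr, rfl⟩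
  · rw [eq_zero_of_mass_eq_zero (hab.symm.trans mass_zero), gap_self, gap_self]
  rcases eq_zero_or_eq_atom b with rfl | ⟨s, y, hs, rfl⟩
  · rw [mass_atom_of_pos hr, mass_zero] at hab
    exact absurd hab hr.ne'
  rw [mass_atom_of_pos hr, mass_atom_of_pos hs] at hab
  subst hab
  rcases eq_zero_or_eq_atom c with rfl | ⟨t, z, ht, rfl⟩
  · simp
  rw [atom_add_atom hr ht, atom_add_atom hr ht, gap_atom (add_pos hr ht) (add_pos hr ht),
    gap_atom hr hr]
  simpa using dist_mix_le hr ht x z y z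

/-- The copies of a are replaced by b one at a time; each replacement turns a + c into b + c next to
a common summand and costs at most one gap. -/
theorem gap_nsmul_add_le {a b c : WithZero (Cone 𝔛)} (hab : mass a = mass b) (n : ℕ) :
    gap (n • a + c) (n • b + c) ≤ n * gap (a + c) (b + c) := by
  induction n with
  | zero => simp [gap_self]
  | succ n ih =>
    have hn : mass (n • a + c) = mass (n • b + c) := by simp only [mass_add, mass_nsmul, hab]
    have hm : mass (a + c) = mass (b + c) := by simp only [mass_add, hab]
    calc gap ((n + 1) • a + c) ((n + 1) • b + c)
        ≤ gap ((n • a + c) + a) ((n • b + c) + a) + gap ((a + c) + n • b) ((b + c) + n • b) := by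
          convert gap_triangle (a := (n + 1) • a + c) (b := (n • b + c) + a)
            (c := (n + 1) • b + c) ?_ ?_ using 3
          · rw [succ_nsmul]; abel
          · abel
          · rw [succ_nsmul]; abel
          · simp only [mass_add, mass_nsmul, hab]; push_cast; ring
          · simp only [mass_add, mass_nsmul, hab]; push_cast; ring
      _ ≤ gap (n • a + c) (n • b + c) + gap (a + c) (b + c) :=
          add_le_add (gap_add_le hn) (gap_add_le hm)
      _ ≤ (n + 1 : ℕ) * gap (a + c) (b + c) := by push_cast; linarith

theorem IsConvexifiable.nsmul_atom (hconv : IsConvexifiable 𝔛) {a : ℝ} (ha : 0 ≤ a) (n : ℕ)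
    (x : 𝔛) : n • atom a x = atom (n * a) x := by
  induction n with
  | zero => simp [atom_zero]
  | succ n ih =>
    rw [succ_nsmul, ih, ← hconv.atom_add (by positivity) ha]
    push_cast
    ring_nf

theorem IsConvexifiable.dist_mix_self_le (hconv : IsConvexifiable 𝔛) {a b : ℝ} (ha : 0 < a)
    (hb : 0 < b) (x z : 𝔛) : (a + b) * dist (mix a b x z) x ≤ b * dist z x := by
  simpa [hconv.mix_self ha hb] using dist_mix_le ha hb x z x x

/-- Cancellation by amplification: against n copies of a and b the fixed summand c becomes
negligible, while by `gap_nsmul_add_le` the gap with c grows at most n-fold. -/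
theorem IsConvexifiable.gap_add_right (hconv : IsConvexifiable 𝔛) {a b : WithZero (Cone 𝔛)}
    (hab : mass a = mass b) (c : WithZero (Cone 𝔛)) : gap (a + c) (b + c) = gap a b := by
  refine le_antisymm (gap_add_le hab) ?_
  rcases eq_zero_or_eq_atom a with rfl | ⟨r, x, hr, rfl⟩
  · rw [gap_zero_left]
    exact gap_nonneg _ _
  rcases eq_zero_or_eq_atom b with rfl | ⟨s, y, hs, rfl⟩
  · rw [gap_zero_right]
    exact gap_nonneg _ _
  rcases eq_zero_or_eq_atom c with rfl | ⟨t, z, ht, rfl⟩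
  · simp
  have hrs := hab
  rw [mass_atom_of_pos hr, mass_atom_of_pos hs] at hrs
  subst hrs
  rw [gap_atom hr hr]
  set G := gap (atom r x + atom t z) (atom r y + atom t z)
  -- By idempotence the n copies sit at x itself. Adding mass t at z moves this point, weighted by
  -- the total mass, by at most t · d(z, x); this error does not depend on n.
  have key (n : ℕ) (hn : 0 < n) : n * (r * dist x y) ≤ n * G + t * (dist z x + dist z y) := by
    have hn' : (0 : ℝ) < n := by exact_mod_cast hn
    have hnr : 0 < n * r := mul_pos hn' hr
    have h1 := gap_nsmul_add_le (c := atom t z) hab n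
    rw [hconv.nsmul_atom hr.le, hconv.nsmul_atom hr.le, atom_add_atom hnr ht, atom_add_atom hnr ht,
      gap_atom (add_pos hnr ht) (add_pos hnr ht)] at h1
    have h2 := hconv.dist_mix_self_le hnr ht x z
    have h3 := hconv.dist_mix_self_le hnr ht y z
    have h4 := dist_triangle4 x (mix (n * r) t x z) (mix (n * r) t y z) y
    rw [dist_comm x (mix _ _ _ _)] at h4
    have h5 : n * r * dist x y ≤ (n * r + t) * dist x y := by
      gcongr
      linarith
    have h6 := mul_le_mul_of_nonneg_left h4 (add_pos hnr ht).le
    rw [mul_add, mul_add] at h6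
    linarith
  by_contra! hlt
  obtain ⟨n, hn⟩ := exists_nat_gt (t * (dist z x + dist z y) / (r * dist x y - G))
  have hpos : 0 < r * dist x y - G := sub_pos.2 hlt
  have hn0 : 0 < n := by
    have : (0 : ℝ) < n := lt_of_le_of_lt (by positivity) hn
    exact_mod_cast this
  rw [div_lt_iff₀ hpos] at hn
  have := key n hn0
  linarith

theorem IsConvexifiable.gap_add_left (hconv : IsConvexifiable 𝔛) {a b : WithZero (Cone 𝔛)}
    (hab : mass a = mass b) (c : WithZero (Cone 𝔛)) : gap (c + a) (c + b) = gap a b := by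
  rw [add_comm c, add_comm c, hconv.gap_add_right hab]

theorem IsConvexifiable.gap_add_add_le (hconv : IsConvexifiable 𝔛) {a b c e : WithZero (Cone 𝔛)}
    (hab : mass a = mass b) (hce : mass c = mass e) :
    gap (a + c) (b + e) ≤ gap a b + gap c e := by
  refine (gap_triangle (b := b + c) ?_ ?_).trans_eq ?_
  · simp only [mass_add, hab]
  · simp only [mass_add, hce]
  · rw [hconv.gap_add_right hab, hconv.gap_add_left hce]

end Gap

/-! ### A seminorm on signed measures of total mass zero. -/

section Barycenter

variable {𝔛 : Type*} [MetricSpace 𝔛] [CCSpace 𝔛]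

/-- The barycenter of the positive part of a finitely supported signed measure, weighted by the
mass of this part. -/
noncomputable def bary (μ : 𝔛 →₀ ℝ) : WithZero (Cone 𝔛) := μ.sum fun x r => atom r x

theorem bary_eq_sum {μ : 𝔛 →₀ ℝ} {s : Finset 𝔛} (hs : μ.support ⊆ s) :
    bary μ = ∑ x ∈ s, atom (μ x) x :=
  Finsupp.sum_of_support_subset μ hs _ fun x _ => atom_zero x

theorem bary_single (a : ℝ) (x : 𝔛) : bary (Finsupp.single x a) = atom a x :=
  Finsupp.sum_single_index (atom_zero x)

theorem IsConvexifiable.bary_add (hconv : IsConvexifiable 𝔛) {μ ν : 𝔛 →₀ ℝ} (hμ : 0 ≤ μ)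
    (hν : 0 ≤ ν) : bary (μ + ν) = bary μ + bary ν := by
  classical
  rw [bary_eq_sum Finsupp.support_add,
    bary_eq_sum (Finset.subset_union_left (s₁ := μ.support) (s₂ := ν.support)),
    bary_eq_sum (Finset.subset_union_right (s₁ := μ.support) (s₂ := ν.support)),
    ← Finset.sum_add_distrib]
  exact Finset.sum_congr rfl fun x _ => hconv.atom_add (hμ x) (hν x) x

theorem IsConvexifiable.bary_sum_single (hconv : IsConvexifiable 𝔛) {ι : Type*} (s : Finset ι)
    (w : ι → ℝ) (v : ι → 𝔛) (hw : ∀ i, 0 ≤ w i) :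
    bary (∑ i ∈ s, Finsupp.single (v i) (w i)) = ∑ i ∈ s, atom (w i) (v i) := by
  classical
  induction s using Finset.induction_on with
  | empty => simp [bary]
  | insert i s hi ih =>
    rw [Finset.sum_insert hi, Finset.sum_insert hi, hconv.bary_add, bary_single, ih]
    · exact Finsupp.single_nonneg.2 (hw i)
    · exact Finset.sum_nonneg fun j _ => Finsupp.single_nonneg.2 (hw j)

/-- This is (μ + ν)⁺ + μ⁻ + ν⁻ = (μ + ν)⁻ + μ⁺ + ν⁺, checked at each point of the support. -/
theorem IsConvexifiable.bary_add_bary_neg (hconv : IsConvexifiable 𝔛) (μ ν : 𝔛 →₀ ℝ) :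
    bary (μ + ν) + (bary (-μ) + bary (-ν)) = bary (-(μ + ν)) + (bary μ + bary ν) := by
  classical
  set s := μ.support ∪ ν.support
  have h1 : (μ + ν).support ⊆ s := Finsupp.support_add
  have h2 : μ.support ⊆ s := Finset.subset_union_left
  have h3 : ν.support ⊆ s := Finset.subset_union_right
  rw [bary_eq_sum h1, bary_eq_sum h2, bary_eq_sum h3,
    bary_eq_sum ((Finsupp.support_neg _).trans_subset h1),
    bary_eq_sum ((Finsupp.support_neg _).trans_subset h2),
    bary_eq_sum ((Finsupp.support_neg _).trans_subset h3), ← Finset.sum_add_distrib,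
    ← Finset.sum_add_distrib, ← Finset.sum_add_distrib, ← Finset.sum_add_distrib]
  refine Finset.sum_congr rfl fun x _ => ?_
  simp only [Finsupp.add_apply, Finsupp.neg_apply]
  set a := μ x
  set b := ν x
  have h0 (r : ℝ) : 0 ≤ max r 0 := le_max_right _ _
  have hr (r : ℝ) : max r 0 - max (-r) 0 = r := max_zero_sub_max_neg_zero_eq_self r
  -- Atoms of negative mass are zero, so masses may be replaced by their positive parts, to which
  -- `IsConvexifiable.atom_add` applies.
  rw [← atom_max_zero (a + b), ← atom_max_zero (-a), ← atom_max_zero (-b),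
    ← atom_max_zero (-(a + b)), ← atom_max_zero a, ← atom_max_zero b,
    ← hconv.atom_add (h0 _) (h0 _), ← hconv.atom_add (h0 _) (h0 _),
    ← hconv.atom_add (h0 _) (add_nonneg (h0 _) (h0 _)),
    ← hconv.atom_add (h0 _) (add_nonneg (h0 _) (h0 _))]
  congr 1
  linarith [hr a, hr b, hr (a + b)]

theorem bary_smul {t : ℝ} (ht : 0 < t) (μ : 𝔛 →₀ ℝ) : bary (t • μ) = scale ht (bary μ) := by
  rw [bary_eq_sum (Finsupp.support_smul (b := t) (g := μ)), bary_eq_sum subset_rfl, map_sum]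
  exact Finset.sum_congr rfl fun x _ => (scale_atom ht _ x).symm

theorem bary_eq_zero_of_nonpos {μ : 𝔛 →₀ ℝ} (hμ : μ ≤ 0) : bary μ = 0 := by
  rw [bary_eq_sum subset_rfl]
  exact Finset.sum_eq_zero fun x _ => dif_neg (not_lt.2 (hμ x))

theorem mass_bary_sub (μ : 𝔛 →₀ ℝ) : mass (bary μ) - mass (bary (-μ)) = total 𝔛 μ := by
  rw [bary_eq_sum subset_rfl, bary_eq_sum (Finsupp.support_neg μ).subset, mass_sum, mass_sum,
    ← Finset.sum_sub_distrib, total, Finsupp.linearCombination_apply, Finsupp.sum]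
  refine Finset.sum_congr rfl fun x _ => ?_
  rw [mass_atom, mass_atom, Finsupp.neg_apply, max_zero_sub_max_neg_zero_eq_self, smul_eq_mul,
    mul_one]

theorem mass_bary_eq_mass_bary_neg {μ : 𝔛 →₀ ℝ} (h : total 𝔛 μ = 0) :
    mass (bary μ) = mass (bary (-μ)) := by
  rw [← sub_eq_zero, mass_bary_sub, h]

/-- The gap of the positive and the negative part of a signed measure of total mass zero. -/
noncomputable def gapNorm (μ : 𝔛 →₀ ℝ) : ℝ := gap (bary μ) (bary (-μ))

theorem gapNorm_nonneg (μ : 𝔛 →₀ ℝ) : 0 ≤ gapNorm μ := gap_nonneg _ _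

theorem gapNorm_smul {t : ℝ} (ht : 0 < t) (μ : 𝔛 →₀ ℝ) : gapNorm (t • μ) = t * gapNorm μ := by
  rw [gapNorm, ← smul_neg, bary_smul ht, bary_smul ht, gap_scale, gapNorm]

/-- Positive parts are not additive, but the discrepancy is a common summand, which cancellation
removes. -/
theorem IsConvexifiable.gapNorm_add_eq (hconv : IsConvexifiable 𝔛) {μ ν : 𝔛 →₀ ℝ}
    (hμν : mass (bary μ + bary ν) = mass (bary (-μ) + bary (-ν))) :
    gapNorm (μ + ν) = gap (bary μ + bary ν) (bary (-μ) + bary (-ν)) := by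
  have h := hconv.bary_add_bary_neg μ ν
  have hm : mass (bary (μ + ν)) = mass (bary (-(μ + ν))) := by
    have := congrArg mass h
    rw [mass_add, mass_add _ (bary μ + bary ν), hμν] at this
    linarith
  rw [gapNorm, ← hconv.gap_add_right hm (bary (-μ) + bary (-ν)), h, hconv.gap_add_left hμν]

theorem IsConvexifiable.gapNorm_add_le (hconv : IsConvexifiable 𝔛) {μ ν : 𝔛 →₀ ℝ}
    (hμ : total 𝔛 μ = 0) (hν : total 𝔛 ν = 0) : gapNorm (μ + ν) ≤ gapNorm μ + gapNorm ν := by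
  have h1 := mass_bary_eq_mass_bary_neg hμ
  have h2 := mass_bary_eq_mass_bary_neg hν
  rw [hconv.gapNorm_add_eq (by rw [mass_add, mass_add, h1, h2])]
  exact hconv.gap_add_add_le h1 h2

/-- The measures μ and ν may overlap: any decomposition into nonnegative measures serves as well as
the Jordan decomposition. -/
theorem IsConvexifiable.gapNorm_sub (hconv : IsConvexifiable 𝔛) {μ ν : 𝔛 →₀ ℝ} (hμ : 0 ≤ μ)
    (hν : 0 ≤ ν) (h : mass (bary μ) = mass (bary ν)) :
    gapNorm (μ - ν) = gap (bary μ) (bary ν) := by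
  have h1 : bary (-μ) = 0 := bary_eq_zero_of_nonpos (neg_nonpos.2 hμ)
  have h2 : bary (-ν) = 0 := bary_eq_zero_of_nonpos (neg_nonpos.2 hν)
  rw [sub_eq_add_neg, hconv.gapNorm_add_eq] <;> simp [h1, h2, h]

end Barycenter

/-! ### Separation of points by affine functions. -/

section Separation

variable {𝔛 : Type*} [MetricSpace 𝔛] [CCSpace 𝔛]

theorem isAffine_of_comb_eq {f : 𝔛 → ℝ} (h : ∀ (n : ℕ) (w : Fin n → ℝ) (x : Fin n → 𝔛),
    (∀ i, 0 < w i) → ∑ i, w i = 1 → f (comb w x) = ∑ i, w i * f (x i)) : IsAffine f := by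
  refine ⟨fun n w x hw hs => (h n w x (fun i => (hw i).1) hs).le, fun n w x hw hs => ?_⟩
  simp [h n w x (fun i => (hw i).1) hs]

/-- `IsAffine` speaks only of weights below one, so the single weight 1 needs `comb_one`. -/
theorem IsAffine.comb_eq {f : 𝔛 → ℝ} (hf : IsAffine f) {n : ℕ} {w : Fin n → ℝ} (x : Fin n → 𝔛)
    (hw : ∀ i, 0 < w i) (hs : ∑ i, w i = 1) : f (comb w x) = ∑ i, w i * f (x i) := by
  match n with
  | 0 => simp at hs
  | 1 =>
    have hw1 : w = fun _ => 1 := by funext i; fin_cases i; simpa using hs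
    have hx : x = fun _ => x 0 := by funext i; fin_cases i; rfl
    rw [hw1, hx, comb_one]
    simp
  | n + 2 =>
    have hlt : ∀ i, w i ∈ Set.Ioo (0 : ℝ) 1 := by
      refine fun i => ⟨hw i, ?_⟩
      obtain ⟨j, hj⟩ := exists_ne i
      rw [← hs]
      exact Finset.single_lt_sum hj (Finset.mem_univ i) (Finset.mem_univ j) (hw j)
        fun k _ _ => (hw k).le
    refine le_antisymm (hf.1 _ w x hlt hs) ?_
    have := hf.2 _ w x hlt hs
    simp only [mul_neg, Finset.sum_neg_distrib] at this
    linarith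

/-- Distances are attained by affine functions of Lipschitz constant one. -/
theorem IsConvexifiable.exists_isAffine_sub_eq_dist (hconv : IsConvexifiable 𝔛) (m m' : 𝔛) :
    ∃ f : 𝔛 → ℝ, LipschitzWith 1 f ∧ IsAffine f ∧ f m - f m' = dist m m' := by
  classical
  rcases eq_or_ne m m' with rfl | hne
  · refine ⟨fun _ => 0, LipschitzWith.const' 0, isAffine_of_comb_eq ?_, by simp⟩
    simp
  let δ : 𝔛 → 𝔛 →₀ ℝ := fun x => Finsupp.single x 1
  have hδ0 (x : 𝔛) : 0 ≤ δ x := Finsupp.single_nonneg.2 zero_le_one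
  -- Subadditivity of `gapNorm` is known only for total mass zero. This projection onto such
  -- measures makes `gapNorm ∘ T` sublinear on the whole space.
  let T : (𝔛 →₀ ℝ) →ₗ[ℝ] (𝔛 →₀ ℝ) := LinearMap.id - (total 𝔛).smulRight (δ m)
  have hTapply (μ : 𝔛 →₀ ℝ) : T μ = μ - total 𝔛 μ • δ m := rfl
  have hT (μ : 𝔛 →₀ ℝ) : total 𝔛 (T μ) = 0 := by
    simp [hTapply, δ, total_single]
  have hT' {μ : 𝔛 →₀ ℝ} (h : total 𝔛 μ = 0) : T μ = μ := by simp [hTapply, h]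
  have hδ (x y : 𝔛) : gapNorm (T (δ x - δ y)) = dist x y := by
    rw [hT' (by simp [δ, total_single]), hconv.gapNorm_sub (hδ0 x) (hδ0 y)]
    · simp [δ, bary_single, gap_atom]
    · simp [δ, bary_single, mass_atom]
  have hv : δ m - δ m' ≠ 0 := by
    intro h
    have h1 := hδ m m'
    have h2 := hδ m m
    rw [h, ← sub_self (δ m), h2, dist_self] at h1
    exact hne (dist_eq_zero.1 h1.symm)
  obtain ⟨g, hg, hgle⟩ := exists_extension_of_le_sublinear
    (LinearPMap.mkSpanSingleton (K := ℝ) (δ m - δ m') (dist m m') hv) (fun μ => gapNorm (T μ))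
    (fun c hc μ => by simp only [map_smul, gapNorm_smul hc])
    (fun μ ν => by
      rw [map_add]
      exact hconv.gapNorm_add_le (hT μ) (hT ν))
    (by
      rintro ⟨μ, hμ⟩
      obtain ⟨c, rfl⟩ := Submodule.mem_span_singleton.1 hμ
      rw [LinearPMap.mkSpanSingleton'_apply]
      simp only [RingHom.id_apply, smul_eq_mul]
      rcases le_or_gt c 0 with hc | hc
      · exact (mul_nonpos_of_nonpos_of_nonneg hc dist_nonneg).trans (gapNorm_nonneg _)
      · rw [map_smul, gapNorm_smul hc, hδ])
  have hsub (x y : 𝔛) : g (δ x) - g (δ y) ≤ dist x y := by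
    rw [← map_sub, ← hδ]
    exact hgle _
  refine ⟨fun x => g (δ x), LipschitzWith.of_le_add fun x y => ?_, isAffine_of_comb_eq ?_, ?_⟩
  · linarith [hsub x y]
  · intro n w x hw hs
    set ν : 𝔛 →₀ ℝ := ∑ i, Finsupp.single (x i) (w i)
    have hgν : ∑ i, w i * g (δ (x i)) = g ν := by
      rw [map_sum]
      refine Finset.sum_congr rfl fun i _ => ?_
      rw [← smul_eq_mul, ← map_smul, Finsupp.smul_single, smul_eq_mul, mul_one]
    have hν0 : 0 ≤ ν := Finset.sum_nonneg fun i _ => Finsupp.single_nonneg.2 (hw i).le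
    have hbν : bary ν = bary (δ (comb w x)) := by
      rw [hconv.bary_sum_single _ _ _ fun i => (hw i).le, sum_atom_eq_atom_comb w x hw hs,
        bary_single]
    have htν : total 𝔛 ν = 1 := by simp [ν, total_single, hs]
    have htδ : total 𝔛 (δ (comb w x)) = 1 := total_single _ _
    -- The measure ν and the unit mass at its barycenter have the same `bary`, so their difference
    -- has seminorm zero in both directions; this forces g to agree on them.
    have e1 : g (δ (comb w x) - ν) ≤ 0 := by
      refine (hgle _).trans_eq ?_
      rw [hT' (by rw [map_sub, htν, htδ, sub_self]), hconv.gapNorm_sub (hδ0 _) hν0 (by rw [hbν]),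
        hbν, gap_self]
    have e2 : g (ν - δ (comb w x)) ≤ 0 := by
      refine (hgle _).trans_eq ?_
      rw [hT' (by rw [map_sub, htν, htδ, sub_self]), hconv.gapNorm_sub hν0 (hδ0 _) (by rw [hbν]),
        hbν, gap_self]
    rw [map_sub] at e1 e2
    rw [hgν]
    linarith
  · rw [← map_sub]
    exact (hg ⟨δ m - δ m', Submodule.mem_span_singleton_self _⟩).trans
      (LinearPMap.mkSpanSingleton_apply ℝ ℝ hv _)

end Separation

/-! ### Expectations of simple elements, and growth of affine functions. -/

section Expectation

variable {Ω 𝔛 : Type*} [MeasurableSpace Ω] [MetricSpace 𝔛] [CCSpace 𝔛]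

theorem IsConvexifiable.comb_const (hconv : IsConvexifiable 𝔛) {n : ℕ} {w : Fin n → ℝ}
    (hw : ∀ i, 0 < w i) (hs : ∑ i, w i = 1) (x : 𝔛) : comb w (fun _ => x) = x := by
  apply atom_injective one_pos
  rw [← sum_atom_eq_atom_comb w _ hw hs, ← hconv.bary_sum_single _ _ _ fun i => (hw i).le,
    ← Finsupp.single_finsetSum, hs, bary_single]

theorem IsConvexifiable.convexify_eq (hconv : IsConvexifiable 𝔛) (x : 𝔛) : convexify x = x := by
  refine tendsto_nhds_unique (tendsto_convexify x) (tendsto_const_nhds.congr' ?_)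
  filter_upwards [eventually_gt_atTop 0] with n hn
  have hn' : (0 : ℝ) < n := by exact_mod_cast hn
  exact (hconv.comb_const (fun _ => inv_pos.2 hn') (by simp [hn'.ne']) x).symm

theorem IsAffine.finsetComb_eq {f : 𝔛 → ℝ} (hf : IsAffine f) {ι : Type*} (s : Finset ι)
    {w : ι → ℝ} (v : ι → 𝔛) (hw : ∀ i ∈ s, 0 < w i) (hs : ∑ i ∈ s, w i = 1) :
    f (finsetComb s w v) = ∑ i ∈ s, w i * f (v i) := by
  have hsum (g : ι → ℝ) : ∑ i : Fin s.card, g (s.equivFin.symm i) = ∑ i ∈ s, g i := by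
    rw [← Finset.sum_coe_sort s g]
    exact Equiv.sum_comp s.equivFin.symm fun i : s => g i
  rw [finsetComb, hf.comb_eq _ (fun i => hw _ (s.equivFin.symm i).2) ((hsum w).trans hs)]
  exact hsum fun i => w i * f (v i)

/-- Affine functions commute with expectations of simple random elements. -/
theorem IsConvexifiable.apply_simpleExpectation (hconv : IsConvexifiable 𝔛) {f : 𝔛 → ℝ}
    (hf : IsAffine f) (P : Measure Ω) [IsProbabilityMeasure P] (Y : SimpleFunc Ω 𝔛) :
    f (simpleExpectation P Y) = ∫ ω, f (Y ω) ∂P := by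
  classical
  have hfilter (g : 𝔛 → ℝ) : ∑ x ∈ Y.range with 0 < P.real (Y ⁻¹' {x}),
      P.real (Y ⁻¹' {x}) * g x = ∑ x ∈ Y.range, P.real (Y ⁻¹' {x}) * g x :=
    Finset.sum_filter_of_ne fun x _ hx =>
      lt_of_le_of_ne measureReal_nonneg (left_ne_zero_of_mul hx).symm
  have hint (g : 𝔛 → ℝ) : ∑ x ∈ Y.range, P.real (Y ⁻¹' {x}) * g x = ∫ ω, g (Y ω) ∂P := by
    have hpt : (fun ω => g (Y ω)) =
        fun ω => ∑ x ∈ Y.range, (Y ⁻¹' {x}).indicator (fun _ => g x) ω := by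
      funext ω
      rw [Finset.sum_eq_single_of_mem (Y ω) (Y.mem_range_self ω)]
      · simp
      · intro x _ hx
        exact Set.indicator_of_notMem (fun h => hx h.symm) _
    rw [hpt, integral_finsetSum _ fun x _ =>
      (integrable_const (g x)).indicator (Y.measurableSet_fiber x)]
    refine Finset.sum_congr rfl fun x _ => ?_
    rw [integral_indicator_const _ (Y.measurableSet_fiber x), smul_eq_mul]
  rw [simpleExpectation, hf.finsetComb_eq]
  · simp only [hconv.convexify_eq]
    rw [hfilter, hint]
  · exact fun x hx => (Finset.mem_filter.1 hx).2
  · have := hfilter fun _ => 1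
    rw [hint] at this
    simpa using this

/-- The expectation of simple random elements is nonexpansive. -/
theorem IsConvexifiable.dist_simpleExpectation_le (hconv : IsConvexifiable 𝔛) (P : Measure Ω)
    [IsProbabilityMeasure P] (Y Z : SimpleFunc Ω 𝔛) :
    dist (simpleExpectation P Y) (simpleExpectation P Z) ≤ ∫ ω, dist (Y ω) (Z ω) ∂P := by
  obtain ⟨f, hlip, hf, hdist⟩ :=
    hconv.exists_isAffine_sub_eq_dist (simpleExpectation P Y) (simpleExpectation P Z)
  have hI (g : 𝔛 → ℝ) (W : SimpleFunc Ω 𝔛) : Integrable (fun ω => g (W ω)) P :=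
    (W.map g).integrable_of_isFiniteMeasure
  rw [← hdist, hconv.apply_simpleExpectation hf, hconv.apply_simpleExpectation hf,
    ← integral_sub (hI f Y) (hI f Z)]
  refine integral_mono ((hI f Y).sub (hI f Z))
    ((Y.pair Z).map fun p : 𝔛 × 𝔛 => dist p.1 p.2).integrable_of_isFiniteMeasure fun ω => ?_
  exact (le_abs_self _).trans (by simpa [Real.dist_eq] using hlip.dist_le_mul (Y ω) (Z ω))

/-- Continuous affine functions grow at most linearly. -/
theorem IsConvexifiable.exists_abs_sub_le (hconv : IsConvexifiable 𝔛) {f : 𝔛 → ℝ}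
    (hf : f ∈ affineDual 𝔛) (a : 𝔛) : ∃ C : ℝ, 0 ≤ C ∧ ∀ x, |f x - f a| ≤ 1 + C * dist x a := by
  obtain ⟨δ, hδ, hball⟩ := Metric.continuous_iff.1 hf.1 a 1 one_pos
  refine ⟨2 / δ, by positivity, fun x => ?_⟩
  rcases lt_or_ge (dist x a) δ with h | h
  · have h1 := hball x h
    rw [Real.dist_eq] at h1
    have : 0 ≤ 2 / δ * dist x a := by positivity
    linarith
  have hd : 0 < dist x a := hδ.trans_le h
  -- With this weight the mixture of x and a lies within δ / 2 of a, where f is controlled by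
  -- continuity; affinity scales the bound back to x by the factor 1 / s.
  set s := δ / (2 * dist x a)
  have hs0 : 0 < s := by positivity
  have hs1 : s < 1 := by
    rw [div_lt_one (by positivity)]
    linarith
  have hs : 0 < 1 - s := sub_pos.2 hs1
  have hdist : dist (mix s (1 - s) x a) a < δ := by
    have h2 := hconv.dist_mix_self_le hs hs0 a x
    rw [mix_comm hs hs0, sub_add_cancel, one_mul] at h2
    have : s * dist x a = δ / 2 := by simp only [s]; field_simp
    linarith
  have h3 := hball _ hdist
  have h4 : f (mix s (1 - s) x a) = s * f x + (1 - s) * f a := by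
    rw [mix_self_one_sub, hf.2.comb_eq]
    · simp
    · intro i
      fin_cases i <;> simp [hs0, hs1]
    · simp
  rw [Real.dist_eq, h4, show s * f x + (1 - s) * f a - f a = s * (f x - f a) by ring, abs_mul,
    abs_of_pos hs0, ← lt_div_iff₀' hs0] at h3
  have h5 : 1 / s = 2 / δ * dist x a := by simp only [s]; field_simp
  linarith

end Expectation

/-! ### Passage to the limit along nearest-point approximations. -/

section Limit

variable {Ω 𝔛 : Type*} [MeasurableSpace Ω] {P : Measure Ω} [MetricSpace 𝔛]
  [MeasurableSpace 𝔛] [BorelSpace 𝔛] {X : Ω → 𝔛} {u : ℕ → 𝔛}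

theorem tendsto_nearestPt_of_denseRange (hu : DenseRange fun j => u (j + 1)) (x : 𝔛) :
    Tendsto (fun n => SimpleFunc.nearestPt u n x) atTop (𝓝 x) :=
  SimpleFunc.tendsto_nearestPt
    (closure_mono (Set.range_comp_subset_range (fun j => j + 1) u) (hu x))

/-- The point u 0 is a candidate at every stage. This gives a bound independent of n for dominated
convergence. -/
theorem dist_nearestPt_le (u : ℕ → 𝔛) (x : 𝔛) (n : ℕ) :
    dist (SimpleFunc.nearestPt u n x) x ≤ dist x (u 0) := by
  have := SimpleFunc.edist_nearestPt_le u x (Nat.zero_le n)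
  rw [edist_dist, edist_dist] at this
  rw [dist_comm x]
  exact (ENNReal.ofReal_le_ofReal_iff dist_nonneg).1 this

variable [TopologicalSpace.SeparableSpace 𝔛]

theorem IsIntegrable.integrable_dist [IsFiniteMeasure P] (hint : IsIntegrable P X)
    (hX : Measurable X) (b : 𝔛) : Integrable (fun ω => dist (X ω) b) P := by
  obtain ⟨a, ha⟩ := hint
  refine (ha.add (integrable_const (dist a b))).mono'
    (hX.dist measurable_const).aestronglyMeasurable (ae_of_all _ fun ω => ?_)
  rw [Real.norm_of_nonneg dist_nonneg, Pi.add_apply, dist_comm a (X ω)]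
  exact dist_triangle _ _ _

theorem measurable_dist_nearestPt (hX : Measurable X) (n : ℕ) :
    Measurable fun ω => dist (SimpleFunc.nearestPt u n (X ω)) (X ω) :=
  ((SimpleFunc.nearestPt u n).measurable.comp hX).dist hX

theorem IsIntegrable.integrable_dist_nearestPt [IsFiniteMeasure P] (hint : IsIntegrable P X)
    (hX : Measurable X) (n : ℕ) :
    Integrable (fun ω => dist (SimpleFunc.nearestPt u n (X ω)) (X ω)) P := by
  refine (hint.integrable_dist hX (u 0)).mono'
    (measurable_dist_nearestPt hX n).aestronglyMeasurable (ae_of_all _ fun ω => ?_)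
  rw [Real.norm_of_nonneg dist_nonneg]
  exact dist_nearestPt_le _ _ _

theorem IsIntegrable.tendsto_integral_dist_nearestPt [IsFiniteMeasure P] (hint : IsIntegrable P X)
    (hX : Measurable X) (hu : DenseRange fun j => u (j + 1)) :
    Tendsto (fun n => ∫ ω, dist (SimpleFunc.nearestPt u n (X ω)) (X ω) ∂P) atTop (𝓝 0) := by
  rw [← integral_zero Ω ℝ (μ := P)]
  refine tendsto_integral_of_dominated_convergence _
    (fun n => (measurable_dist_nearestPt hX n).aestronglyMeasurable)
    (hint.integrable_dist hX (u 0)) (fun n => ae_of_all _ fun ω => ?_) (ae_of_all _ fun ω => ?_)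
  · rw [Real.norm_of_nonneg dist_nonneg]
    exact dist_nearestPt_le _ _ _
  · exact tendsto_iff_dist_tendsto_zero.1 (tendsto_nearestPt_of_denseRange hu (X ω))

variable [CCSpace 𝔛]

theorem IsConvexifiable.integrable_comp [IsFiniteMeasure P] (hconv : IsConvexifiable 𝔛)
    {f : 𝔛 → ℝ} (hf : f ∈ affineDual 𝔛) (hint : IsIntegrable P X) (hX : Measurable X) :
    Integrable (fun ω => f (X ω)) P := by
  -- Only some base point is needed; `id` keeps `hint` available.
  obtain ⟨a, -⟩ := id hint
  obtain ⟨C, -, hC⟩ := hconv.exists_abs_sub_le hf a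
  refine Integrable.mono' (g := fun ω => 1 + C * dist (X ω) a + |f a|) ?_
    (hf.1.measurable.comp hX).aestronglyMeasurable (ae_of_all _ fun ω => ?_)
  · exact ((integrable_const _).add ((hint.integrable_dist hX a).const_mul C)).add
      (integrable_const _)
  · rw [Real.norm_eq_abs]
    have := abs_sub_abs_le_abs_sub (f (X ω)) (f a)
    linarith [hC (X ω)]

theorem IsConvexifiable.tendsto_integral_comp_nearestPt [IsFiniteMeasure P]
    (hconv : IsConvexifiable 𝔛) {f : 𝔛 → ℝ} (hf : f ∈ affineDual 𝔛) (hint : IsIntegrable P X)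
    (hX : Measurable X) (hu : DenseRange fun j => u (j + 1)) :
    Tendsto (fun n => ∫ ω, f (SimpleFunc.nearestPt u n (X ω)) ∂P) atTop
      (𝓝 (∫ ω, f (X ω) ∂P)) := by
  obtain ⟨C, hC0, hC⟩ := hconv.exists_abs_sub_le hf (u 0)
  refine tendsto_integral_of_dominated_convergence
    (fun ω => 1 + C * (2 * dist (X ω) (u 0)) + |f (u 0)|)
    (fun n => (hf.1.measurable.comp
      ((SimpleFunc.nearestPt u n).measurable.comp hX)).aestronglyMeasurable) ?_
    (fun n => ae_of_all _ fun ω => ?_) (ae_of_all _ fun ω => ?_)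
  · exact ((integrable_const _).add
      (((hint.integrable_dist hX (u 0)).const_mul 2).const_mul C)).add (integrable_const _)
  · rw [Real.norm_eq_abs]
    have h1 := abs_sub_abs_le_abs_sub (f (SimpleFunc.nearestPt u n (X ω))) (f (u 0))
    have h2 := hC (SimpleFunc.nearestPt u n (X ω))
    have h3 : dist (SimpleFunc.nearestPt u n (X ω)) (u 0) ≤ 2 * dist (X ω) (u 0) := by
      linarith [dist_triangle (SimpleFunc.nearestPt u n (X ω)) (X ω) (u 0),
        dist_nearestPt_le u (X ω) n]
    have h4 := mul_le_mul_of_nonneg_left h3 hC0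
    linarith
  · exact (hf.1.tendsto _).comp (tendsto_nearestPt_of_denseRange hu (X ω))

/-- The approximations converge to X in L¹ distance, and the simple expectation is nonexpansive for
that distance. -/
theorem IsConvexifiable.cauchySeq_simpleExpectation [IsProbabilityMeasure P]
    (hconv : IsConvexifiable 𝔛) (hint : IsIntegrable P X) (hX : Measurable X)
    (hu : DenseRange fun j => u (j + 1)) :
    CauchySeq fun n => simpleExpectation P ((SimpleFunc.nearestPt u n).comp X hX) := by
  set e : ℕ → ℝ := fun n => ∫ ω, dist (SimpleFunc.nearestPt u n (X ω)) (X ω) ∂P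
  have he : Tendsto e atTop (𝓝 0) := hint.tendsto_integral_dist_nearestPt hX hu
  have hle (n k : ℕ) : dist (simpleExpectation P ((SimpleFunc.nearestPt u n).comp X hX))
      (simpleExpectation P ((SimpleFunc.nearestPt u k).comp X hX)) ≤ e n + e k := by
    have hn := hint.integrable_dist_nearestPt (u := u) hX n
    have hk := hint.integrable_dist_nearestPt (u := u) hX k
    refine (hconv.dist_simpleExpectation_le P _ _).trans ?_
    rw [← integral_add hn hk]
    refine integral_mono_of_nonneg (ae_of_all _ fun ω => dist_nonneg) (hn.add hk)
      (ae_of_all _ fun ω => ?_)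
    exact dist_triangle_right _ _ _
  refine Metric.cauchySeq_iff.2 fun ε hε => ?_
  obtain ⟨N, hN⟩ := eventually_atTop.1 (he.eventually_lt_const (half_pos hε))
  exact ⟨N, fun n hn k hk => by linarith [hle n k, hN n hn, hN k hk]⟩

end Limit

end CCSpace

/-! ### The characterization of the expectation. -/

theorem theorem4p4 {Ω 𝔛 : Type*} [MeasurableSpace Ω] (P : Measure Ω) [IsProbabilityMeasure P]
    [MetricSpace 𝔛] [CompleteSpace 𝔛] [TopologicalSpace.SeparableSpace 𝔛]
    [MeasurableSpace 𝔛] [BorelSpace 𝔛] [CCSpace 𝔛] (hconv : CCSpace.IsConvexifiable 𝔛)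
    (u : ℕ → 𝔛) (hu0 : u 0 ∈ CCSpace.convexifiableDomain 𝔛) (hu : DenseRange fun j => u (j + 1))
    (X : Ω → 𝔛) (hX : Measurable X) (hint : CCSpace.IsIntegrable P X) :
    (∀ f ∈ CCSpace.affineDual 𝔛, Integrable (fun ω => f (X ω)) P) ∧
      (∃ m : 𝔛, CCSpace.IsExpectation P u X hX m) ∧
      ∀ m : 𝔛, CCSpace.IsExpectation P u X hX m ↔
        ∀ f ∈ CCSpace.affineDual 𝔛, f m = ∫ ω, f (X ω) ∂P := by
  obtain ⟨l, hl⟩ :=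
    cauchySeq_tendsto_of_complete (hconv.cauchySeq_simpleExpectation hint hX hu)
  have hfl {m : 𝔛} (hm : CCSpace.IsExpectation P u X hX m) (f : 𝔛 → ℝ)
      (hf : f ∈ CCSpace.affineDual 𝔛) : f m = ∫ ω, f (X ω) ∂P := by
    refine tendsto_nhds_unique ((hf.1.tendsto m).comp hm)
      ((hconv.tendsto_integral_comp_nearestPt hf hint hX hu).congr fun n => ?_)
    exact (hconv.apply_simpleExpectation hf.2 P ((SimpleFunc.nearestPt u n).comp X hX)).symm
  refine ⟨fun f hf => hconv.integrable_comp hf hint hX, ⟨l, hl⟩, fun m => ⟨hfl, fun h => ?_⟩⟩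
  -- Every dual function takes the same value at m and at the limit l; the one that attains d(m, l)
  -- forces m = l.
  obtain ⟨f, hlip, haff, hdist⟩ := hconv.exists_isAffine_sub_eq_dist m l
  have hf : f ∈ CCSpace.affineDual 𝔛 := ⟨hlip.continuous, haff⟩
  rw [h f hf, hfl hl f hf, sub_self, eq_comm, dist_eq_zero] at hdist
  exact hdist ▸ hl
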